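/- Let $(\Omega,\mu)$ be an atomless standard probability space and let $W:\Omega^2\to[0,1]$ be a graphon (a symmetric measurable function). Write $\deg_W(x)=\int_\Omega W(x,y)\,d\mu(y)$, and suppose that (I) $W$ is connected: $\int_{S\times T}W>0$ whenever $\Omega=S\sqcup T$ with $\mu(S),\mu(T)>0$; (II) $\lim_{\alpha\searrow 0}\mu(\{x:\deg_W(x)\le\alpha\})/\alpha=0$; (III) $W$ has no peninsula: there are no $a\in(0,\frac12]$ and disjoint measurable $A,B\subseteq\Omega$ with $\mu(A)=a$, $\mu(B)=1-2a$ and $W=0$ almost everywhere on $A\times(A\cup B)$. A weighted graph $R$ is a finite simple graph with a weight $w(uv)\in[0,1]$ on each edge $uv$ (put $w(uv)=0$ for non-edges). Let $n$ be its order, $\deg_R(v)=\sum_u w(uv)$, and $\mathsf D_R(\delta)=\{v\in V(R):\deg_R(v)<\delta n\}$. The cut distance of $R$ from $W$ is less than $\varepsilon$ if there is a partition $\Omega=\bigsqcup_{v\in V(R)}\Omega_v$ into measurable sets of measure $\frac1n$ each such that the function $U$ that is constantly $w(uv)$ on every $\Omega_u\times\Omega_v$ satisfies $\sup_{S,T}\left|\int_{S\times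 T}(W-U)\,d\mu^2\right|<\varepsilon$, the supremum being over measurable $S,T\subseteq\Omega$. A graph $G$ is uniquely half-covered if the constant function $\frac12$ is the only function $f:V(G)\to\{0,\frac12,1\}$ with $f(u)+f(v)\ge1$ for every edge $uv$ and $\sum_v f(v)\le\frac12|V(G)|$. Then for every $C>1$ and $\gamma\in(0,\frac1{20C})$ there exist $\varepsilon,\alpha_0\in(0,1]$ such that for every weighted graph $R$ of order $n$ whose cut distance from $W$ is less than $\varepsilon$, the graph $R^*:=R-\mathsf D_R(\alpha_0)$ and every set $A\subseteq V(R^*)$ with $|A|\le C\gamma\alpha_0 n$ satisfy: (a) $|V(R)\setminus V(R^*)|=|\mathsf D_R(\alpha_0)|\le\gamma\alpha_0 n$; (b) $R^*-A$ is uniquely half-covered; (c) $R^*-A$ is connected. -/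

import Mathlib

open MeasureTheory Set Filter Topology

noncomputable section

/-! ### Graphons -/

/-- A graphon on `Ω`: a symmetric measurable function `Ω² → [0,1]`. -/
structure Graphon (Ω : Type*) [MeasurableSpace Ω] where
  toFun : Ω → Ω → ℝ
  measurable_toFun : Measurable (Function.uncurry toFun)
  symm : ∀ x y, toFun x y = toFun y x
  nonneg : ∀ x y, 0 ≤ toFun x y
  le_one : ∀ x y, toFun x y ≤ 1

namespace Graphon

variable {Ω : Type*} [MeasurableSpace Ω]

/-- The graphon `W` is connected: whenever `Ω = S ⊔ T` with both parts of positive measure,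
`∫_{S × T} W > 0`. -/
def IsConnected (W : Graphon Ω) (μ : Measure Ω) : Prop :=
  ∀ S T : Set Ω, MeasurableSet S → MeasurableSet T → Disjoint S T → S ∪ T = univ →
    0 < μ S → 0 < μ T → 0 < ∫ z in S ×ˢ T, W.toFun z.1 z.2 ∂(μ.prod μ)

/-- The degree of a point, `deg_W(x) = ∫ W(x,y) dμ(y)`. -/
def deg (W : Graphon Ω) (μ : Measure Ω) (x : Ω) : ℝ := ∫ y, W.toFun x y ∂μ

/-- The points of degree at most `α`. -/
def lowDeg (W : Graphon Ω) (μ : Measure Ω) (α : ℝ) : Set Ω := {x | W.deg μ x ≤ α}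

/-- The tail of points of small degree is light: `μ(D_W(α)) / α → 0` as `α ↘ 0`. -/
def HasLightTail (W : Graphon Ω) (μ : Measure Ω) : Prop :=
  Tendsto (fun α : ℝ => μ.real (W.lowDeg μ α) / α) (𝓝[>] 0) (𝓝 0)

/-- `W` has a peninsula: for some `a ∈ (0, 1/2]` there are disjoint measurable sets `A`, `B` of
measures `a` and `1 - 2a` such that `W` vanishes almost everywhere on `A × (A ∪ B)`
(graphons are identified when they agree almost everywhere). -/
def HasPeninsula (W : Graphon Ω) (μ : Measure Ω) : Prop :=
  ∃ a : ℝ, 0 < a ∧ a ≤ 1 / 2 ∧ ∃ A B : Set Ω, MeasurableSet A ∧ MeasurableSet B ∧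
    Disjoint A B ∧ μ.real A = a ∧ μ.real B = 1 - 2 * a ∧
    ∀ᵐ z ∂(μ.prod μ), z ∈ A ×ˢ (A ∪ B) → W.toFun z.1 z.2 = 0

end Graphon

/-- The cut norm `sup_{S,T} |∫_{S × T} F|`, over measurable `S`, `T`. (It is used only for the
difference of two `[0,1]`-valued measurable functions on a probability space, where the set is
bounded.) -/
def cutNorm {Ω : Type*} [MeasurableSpace Ω] (μ : Measure Ω) (F : Ω → Ω → ℝ) : ℝ :=
  sSup {r : ℝ | ∃ S T : Set Ω, MeasurableSet S ∧ MeasurableSet T ∧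
    r = |∫ z in S ×ˢ T, F z.1 z.2 ∂(μ.prod μ)|}

/-! ### Weighted graphs -/

/-- A weighted graph: a (simple) graph together with a weight in `[0,1]` on every edge. The weight
function is extended by `0` to the pairs that are not edges. Edges of weight `0` are allowed. -/
structure WeightedGraph (V : Type*) where
  graph : SimpleGraph V
  weight : V → V → ℝ
  weight_symm : ∀ u v, weight u v = weight v u
  weight_nonneg : ∀ u v, 0 ≤ weight u v
  weight_le_one : ∀ u v, weight u v ≤ 1
  weight_of_not_adj : ∀ u v, ¬ graph.Adj u v → weight u v = 0

namespace WeightedGraph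

variable {V : Type*}

/-- The weighted degree `∑_u w(uv)`. -/
def deg [Finite V] (R : WeightedGraph V) (v : V) : ℝ := ∑ᶠ u, R.weight u v

/-- The vertices of degree less than `δ n`, where `n` is the order of `R`. -/
def lowDeg [Finite V] (R : WeightedGraph V) (δ : ℝ) : Set V :=
  {v | R.deg v < δ * Nat.card V}

/-- Deletion of a set `D` of vertices; the remaining edges keep their weights. -/
def deleteVerts (R : WeightedGraph V) (D : Set V) : WeightedGraph (Dᶜ : Set V) where
  graph := R.graph.induce Dᶜ
  weight u v := R.weight u v
  weight_symm u v := R.weight_symm u v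
  weight_nonneg u v := R.weight_nonneg u v
  weight_le_one u v := R.weight_le_one u v
  weight_of_not_adj u v h := R.weight_of_not_adj u v h

/-- `U` is a graphon representation of `R`: for a partition of `Ω` into measurable sets
`Ω_v = c ⁻¹' {v}`, `v ∈ V`, of measure `1 / n` each, `U` is constant `w(uv)` on `Ω_u × Ω_v` if
`uv` is an edge and constant `0` there otherwise. -/
def IsRepresentation {Ω : Type*} [MeasurableSpace Ω] [Finite V] (μ : Measure Ω)
    (R : WeightedGraph V) (U : Ω → Ω → ℝ) : Prop :=
  ∃ c : Ω → V, (∀ v, MeasurableSet (c ⁻¹' {v})) ∧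
    (∀ v, μ.real (c ⁻¹' {v}) = 1 / (Nat.card V : ℝ)) ∧
    ∀ x y, U x y = R.weight (c x) (c y)

/-- The cut distance of `R` from the graphon `W` is less than `ε`. -/
def CutDistLT {Ω : Type*} [MeasurableSpace Ω] [Finite V] (μ : Measure Ω)
    (R : WeightedGraph V) (W : Graphon Ω) (ε : ℝ) : Prop :=
  ∃ U : Ω → Ω → ℝ, R.IsRepresentation μ U ∧ cutNorm μ (fun x y => W.toFun x y - U x y) < ε

end WeightedGraph

/-! ### Half-integral vertex covers -/

/-- `f` is a half-integral vertex cover of `G`. -/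
def IsHalfIntegralVertexCover {V : Type*} (G : SimpleGraph V) (f : V → ℝ) : Prop :=
  (∀ v, f v = 0 ∨ f v = 1 / 2 ∨ f v = 1) ∧ ∀ u v, G.Adj u v → 1 ≤ f u + f v

/-- `G` is uniquely half-covered: the only half-integral vertex cover of total weight at most
half the order of `G` is the constant function `1/2`. -/
def IsUniquelyHalfCovered {V : Type*} [Finite V] (G : SimpleGraph V) : Prop :=
  ∀ f : V → ℝ, (IsHalfIntegralVertexCover G f ∧ ∑ᶠ v, f v ≤ (Nat.card V : ℝ) / 2) ↔
    f = fun _ => 1 / 2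

end

/-! Compactness makes (I) and (III) quantitative. If sets violated them with error tending to 0,
their indicators would have weak limits in L² along a subsequence; the mass of `W` between the sets
passes to the limit, and the supports of the limits would disconnect `W` or give a peninsula. So for
each β there is a δ that works for all sets of measure at least β, and cut distance carries this
over to `R`.

Smaller sets need (II). Let X have sn vertices, all of degree at least αn, with neighbourhood of at
most (s + α/10)n vertices. Then s is at least 9α/10, and the average `W`-degree on X is about s +
α/10 at most. By Markov and the light tail, the measure s of X is at most a small multiple of
itself, which is absurd unless s ≥ t₀/8. This is `le_card_div`.

A component and its complement, or the zero set of a half-integral cover with its neighbourhood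
inside the one set, are such X. They are therefore large and contradict the quantitative (I) or
(III). -/

noncomputable section

/-! ### Weak limits of sets and the cut functional -/

section WeakLimits

variable {Ω : Type*} [MeasurableSpace Ω]

/-- In an atomless standard probability space every measurable set has measurable subsets of any
smaller measure. -/
theorem exists_measurableSet_subset_real_eq [StandardBorelSpace Ω] (μ : Measure Ω)
    [IsProbabilityMeasure μ] [NullSingletonClass μ] {S : Set Ω} (hS : MeasurableSet S) {a : ℝ}
    (ha0 : 0 ≤ a) (ha : a ≤ μ.real S) : ∃ A ⊆ S, MeasurableSet A ∧ μ.real A = a := by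
  rcases ha0.eq_or_lt with rfl | ha0
  · exact ⟨∅, empty_subset _, .empty, by simp⟩
  rcases ha.eq_or_lt with rfl | ha
  · exact ⟨S, Subset.rfl, hS, rfl⟩
  -- Transported to ℝ, the measure on `S` has no atoms, so its distribution function is continuous
  -- and takes the value `a`.
  have he := measurableEmbedding_embeddingReal Ω
  set e := embeddingReal Ω
  set ν : Measure ℝ := (μ.restrict S).map e with hν
  have hνr : ∀ B : Set ℝ, MeasurableSet B → ν.real B = μ.real (e ⁻¹' B ∩ S) := by
    intro B hB
    simp only [Measure.real, hν]
    rw [Measure.map_apply he.measurable hB, Measure.restrict_apply (he.measurable hB)]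
  have hfin : IsFiniteMeasure ν := by rw [hν]; infer_instance
  have hatom : NullSingletonClass ν := by
    refine ⟨fun x => ?_⟩
    rw [hν, Measure.map_apply he.measurable (measurableSet_singleton x),
      Measure.restrict_apply (he.measurable (measurableSet_singleton x))]
    refine measure_mono_null inter_subset_left ?_
    exact (subsingleton_singleton.preimage he.injective).measure_zero μ
  have hcont : Continuous fun t : ℝ => ν.real (Iic t) := by
    have h1 : ∀ t : ℝ, ν.real (Iic t) = ν.real (Iic 0) + ∫ _ in (0 : ℝ)..t, (1 : ℝ) ∂ν := by
      intro t
      rw [← intervalIntegral.integral_Iic_sub_Iic (integrable_const _).integrableOn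
        (integrable_const _).integrableOn, setIntegral_const, setIntegral_const, smul_eq_mul,
        smul_eq_mul, mul_one, mul_one, add_sub_cancel]
    rw [funext h1]
    exact continuous_const.add (intervalIntegral.continuous_primitive
      (fun a b => (integrable_const _).intervalIntegrable) 0)
  have hbot : Tendsto (fun t : ℝ => ν.real (Iic t)) atBot (𝓝 0) := by
    have h1 : Tendsto (fun t : ℝ => ν (Iic t)) atBot (𝓝 (ν (⋂ t : ℝ, Iic t))) :=
      tendsto_measure_iInter_atBot (fun _ => measurableSet_Iic.nullMeasurableSet)
        (fun _ _ h => Iic_subset_Iic.2 h) ⟨0, measure_ne_top _ _⟩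
    rw [iInter_Iic_eq_empty_iff.2 (by simp [not_bddBelow_univ]), measure_empty] at h1
    exact (ENNReal.tendsto_toReal ENNReal.zero_ne_top).comp h1
  have htop : Tendsto (fun t : ℝ => ν.real (Iic t)) atTop (𝓝 (μ.real S)) := by
    have := (ENNReal.tendsto_toReal (measure_ne_top ν univ)).comp (tendsto_measure_Iic_atTop ν)
    have h2 : (ν univ).toReal = μ.real S := by
      have := hνr univ .univ
      simpa [Measure.real] using this
    rw [h2] at this
    exact this
  obtain ⟨t1, ht1⟩ := (hbot.eventually (gt_mem_nhds ha0)).exists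
  obtain ⟨t2, ht2⟩ := (htop.eventually (lt_mem_nhds ha)).exists
  obtain ⟨t, ht⟩ := mem_range_of_exists_le_of_exists_ge hcont ⟨t1, ht1.le⟩ ⟨t2, ht2.le⟩
  refine ⟨e ⁻¹' Iic t ∩ S, inter_subset_right, (he.measurable measurableSet_Iic).inter hS, ?_⟩
  rw [← hνr _ measurableSet_Iic]
  exact ht

/-- The indicators of the sets `S k` converge weakly to `f`. -/
def IsWeakLimit (μ : Measure Ω) (S : ℕ → Set Ω) (f : Ω → ℝ) : Prop :=
  ∀ h : Ω → ℝ, MemLp h 2 μ → Tendsto (fun k => ∫ x in S k, h x ∂μ) atTop (𝓝 (∫ x, f x * h x ∂μ))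

theorem IsWeakLimit.tendsto_real_inter {μ : Measure Ω} [IsProbabilityMeasure μ]
    {S : ℕ → Set Ω} {f : Ω → ℝ} (h : IsWeakLimit μ S f) {E : Set Ω} (hE : MeasurableSet E) :
    Tendsto (fun k => μ.real (S k ∩ E)) atTop (𝓝 (∫ x in E, f x ∂μ)) := by
  have := h (E.indicator fun _ => 1) (memLp_indicator_const 2 hE 1 (.inr (measure_ne_top μ E)))
  convert! this using 2 with k
  · rw [setIntegral_indicator hE]; simp
  · rw [← integral_indicator hE]
    congr 1 with x
    by_cases hx : x ∈ E <;> simp [hx]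

/-- Sequential Banach–Alaoglu in L², which is separable because the σ-algebra is countably
generated; Riesz turns the limit functional into a function. -/
theorem exists_isWeakLimit_comp [MeasurableSpace.CountablyGenerated Ω] (μ : Measure Ω)
    [IsProbabilityMeasure μ] (S : ℕ → Set Ω) (hS : ∀ k, MeasurableSet (S k)) :
    ∃ f : Ω → ℝ, Measurable f ∧ (∀ x, 0 ≤ f x) ∧ (∀ x, f x ≤ 1) ∧
      ∃ φ : ℕ → ℕ, StrictMono φ ∧ IsWeakLimit μ (S ∘ φ) f := by
  have : Fact ((2 : ENNReal) ≠ ⊤) := ⟨by norm_num⟩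
  let s : ℕ → Lp ℝ 2 μ := fun k => indicatorConstLp 2 (hS k) (measure_ne_top μ _) (1 : ℝ)
  have hs : ∀ k, ‖s k‖ ≤ 1 := by
    intro k
    refine norm_indicatorConstLp_le.trans ?_
    simp only [norm_one, one_mul]
    exact Real.rpow_le_one measureReal_nonneg measureReal_le_one (by simp)
  have hinner : ∀ (k : ℕ) (h : Lp ℝ 2 μ), inner ℝ (s k) h = ∫ x in S k, h x ∂μ := by
    intro k h
    exact L2.inner_indicatorConstLp_one (hS k) (measure_ne_top μ _) h
  have hsc := WeakDual.isSeqCompact_closedBall ℝ (Lp ℝ 2 μ) 0 1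
  let L : ℕ → WeakDual ℝ (Lp ℝ 2 μ) := fun k =>
    StrongDual.toWeakDual (InnerProductSpace.toDual ℝ (Lp ℝ 2 μ) (s k))
  obtain ⟨ℓ, -, φ, hφ, hlim⟩ := hsc (x := L) (fun k => by
    simp only [mem_preimage, Metric.mem_closedBall, dist_zero_right]
    exact ((InnerProductSpace.toDual ℝ (Lp ℝ 2 μ)).norm_map (s k)).le.trans (hs k))
  set g : Lp ℝ 2 μ := (InnerProductSpace.toDual ℝ (Lp ℝ 2 μ)).symm (WeakDual.toStrongDual ℓ)
  have hg : ∀ h : Ω → ℝ, MemLp h 2 μ →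
      Tendsto (fun k => ∫ x in S (φ k), h x ∂μ) atTop (𝓝 (∫ x, g x * h x ∂μ)) := by
    intro h hh
    have h1 := (WeakDual.eval_continuous (𝕜 := ℝ) (hh.toLp h)).tendsto ℓ |>.comp hlim
    have h2 : ∀ k, (L (φ k)) (hh.toLp h) = ∫ x in S (φ k), h x ∂μ := by
      intro k
      have : (L (φ k)) (hh.toLp h) = inner ℝ (s (φ k)) (hh.toLp h) :=
        InnerProductSpace.toDual_apply_apply
      rw [this, hinner]
      exact integral_congr_ae (ae_restrict_of_ae hh.coeFn_toLp)
    have h3 : ℓ (hh.toLp h) = ∫ x, g x * h x ∂μ := by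
      have : ℓ (hh.toLp h) = inner ℝ g (hh.toLp h) :=
        (InnerProductSpace.toDual_symm_apply (y := WeakDual.toStrongDual ℓ)).symm
      rw [this, L2.inner_def]
      refine integral_congr_ae ?_
      filter_upwards [hh.coeFn_toLp] with x hx
      simp [hx, mul_comm]
    simpa only [Function.comp_def, h2, h3] using h1
  have hgi : Integrable g μ := (Lp.memLp g).integrable (by norm_num)
  have hind : ∀ E : Set Ω, MeasurableSet E →
      Tendsto (fun k => μ.real (S (φ k) ∩ E)) atTop (𝓝 (∫ x in E, g x ∂μ)) :=
    fun E hE => IsWeakLimit.tendsto_real_inter (S := S ∘ φ) hg hE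
  have hg0 : ∀ᵐ x ∂μ, 0 ≤ g x := by
    refine ae_nonneg_of_forall_setIntegral_nonneg hgi fun E hE _ => ?_
    exact ge_of_tendsto' (hind E hE) fun k => measureReal_nonneg
  have hg1 : ∀ᵐ x ∂μ, g x ≤ 1 := by
    refine ae_le_of_forall_setIntegral_le hgi (integrable_const 1) fun E hE _ => ?_
    refine le_of_tendsto' (hind E hE) fun k => ?_
    simpa using measureReal_mono inter_subset_right
  have hgm : AEMeasurable g μ := hgi.aemeasurable
  -- Truncating a measurable representative makes the almost everywhere bounds hold pointwise.
  refine ⟨fun x => max 0 (min 1 (hgm.mk g x)), ?_, fun x => le_max_left _ _,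
    fun x => max_le zero_le_one (min_le_left _ _), φ, hφ, ?_⟩
  · exact measurable_const.max (measurable_const.min hgm.measurable_mk)
  · intro h hh
    have := hg h hh
    convert! this using 2
    refine integral_congr_ae ?_
    filter_upwards [hg0, hg1, hgm.ae_eq_mk] with x h0 h1 h2
    simp only [← h2, min_eq_right h1, max_eq_right h0]

variable {μ : Measure Ω} [IsProbabilityMeasure μ] {S T : ℕ → Set Ω} {f g : Ω → ℝ}

omit [IsProbabilityMeasure μ] in
theorem IsWeakLimit.comp (h : IsWeakLimit μ S f) {φ : ℕ → ℕ} (hφ : StrictMono φ) :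
    IsWeakLimit μ (S ∘ φ) f :=
  fun u hu => (h u hu).comp hφ.tendsto_atTop

theorem memLp_of_unit_interval {p : ENNReal} (hf : Measurable f) (h0 : ∀ x, 0 ≤ f x)
    (h1 : ∀ x, f x ≤ 1) : MemLp f p μ :=
  MemLp.of_bound hf.aestronglyMeasurable 1 (ae_of_all _ fun x => by
    rw [Real.norm_of_nonneg (h0 x)]; exact h1 x)

theorem IsWeakLimit.compl (hS : ∀ k, MeasurableSet (S k)) (hf : Measurable f) (h0 : ∀ x, 0 ≤ f x)
    (h1 : ∀ x, f x ≤ 1) (h : IsWeakLimit μ S f) :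
    IsWeakLimit μ (fun k => (S k)ᶜ) (fun x => 1 - f x) := by
  intro u hu
  have hui : Integrable u μ := hu.integrable (by norm_num)
  have h2 : ∫ x, (1 - f x) * u x ∂μ = ∫ x, u x ∂μ - ∫ x, f x * u x ∂μ := by
    simp_rw [sub_mul, one_mul]
    refine integral_sub hui (hui.bdd_mul (c := 1) hf.aestronglyMeasurable (ae_of_all _ fun x => ?_))
    rw [Real.norm_of_nonneg (h0 x)]; exact h1 x
  rw [h2]
  refine ((h u hu).const_sub _).congr fun k => ?_
  rw [← integral_add_compl (hS k) hui]; ring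

theorem IsWeakLimit.tendsto_real (h : IsWeakLimit μ S f) :
    Tendsto (fun k => μ.real (S k)) atTop (𝓝 (∫ x, f x ∂μ)) := by
  simpa using h.tendsto_real_inter MeasurableSet.univ

theorem IsWeakLimit.ae_le (hf : Integrable f μ) (hg : Integrable g μ) (h : IsWeakLimit μ S f)
    (h' : IsWeakLimit μ T g) (hST : ∀ k, S k ⊆ T k) : ∀ᵐ x ∂μ, f x ≤ g x := by
  refine ae_le_of_forall_setIntegral_le hf hg fun E hE _ => ?_
  exact le_of_tendsto_of_tendsto' (h.tendsto_real_inter hE) (h'.tendsto_real_inter hE)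
    fun k => measureReal_mono (inter_subset_inter_left _ (hST k))

theorem Graphon.integrable (W : Graphon Ω) :
    Integrable (fun z : Ω × Ω => W.toFun z.1 z.2) (μ.prod μ) :=
  (memLp_of_unit_interval W.measurable_toFun (fun z => W.nonneg z.1 z.2)
    (fun z => W.le_one z.1 z.2)).integrable (q := 1) le_rfl

theorem Graphon.measurable_right (W : Graphon Ω) (x : Ω) : Measurable (W.toFun x) :=
  W.measurable_toFun.comp measurable_prodMk_left

theorem Graphon.integrable_right (W : Graphon Ω) (x : Ω) : Integrable (W.toFun x) μ :=
  (memLp_of_unit_interval (W.measurable_right x) (W.nonneg x) (W.le_one x)).integrable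
    (q := 1) le_rfl

/-- The cut functional of a graphon is continuous under weak limits. -/
theorem Graphon.tendsto_setIntegral_prod (W : Graphon Ω)
    (hg : Measurable g) (hg0 : ∀ x, 0 ≤ g x) (hg1 : ∀ x, g x ≤ 1)
    (hSf : IsWeakLimit μ S f) (hTg : IsWeakLimit μ T g) :
    Tendsto (fun k => ∫ z in S k ×ˢ T k, W.toFun z.1 z.2 ∂(μ.prod μ)) atTop
      (𝓝 (∫ x, f x * ∫ y, g y * W.toFun x y ∂μ ∂μ)) := by
  have hgW : Measurable (Function.uncurry fun x y => g y * W.toFun x y) :=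
    (hg.comp measurable_snd).mul W.measurable_toFun
  set h : Ω → ℝ := fun x => ∫ y, g y * W.toFun x y ∂μ with hh
  have hhm : Measurable h := (hgW.stronglyMeasurable.integral_prod_right).measurable
  have hgWi : ∀ x, Integrable (fun y => g y * W.toFun x y) μ := fun x =>
    (memLp_of_unit_interval (hg.mul (W.measurable_right x))
      (fun y => mul_nonneg (hg0 y) (W.nonneg x y))
      (fun y => mul_le_one₀ (hg1 y) (W.nonneg x y) (W.le_one x y))).integrable (q := 1) le_rfl
  have hh0 : ∀ x, 0 ≤ h x := fun x =>
    integral_nonneg fun y => mul_nonneg (hg0 y) (W.nonneg x y)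
  have hh1 : ∀ x, h x ≤ 1 := fun x => by
    have := integral_mono (hgWi x) (integrable_const (1 : ℝ))
      (fun y => mul_le_one₀ (hg1 y) (W.nonneg x y) (W.le_one x y))
    simpa using this
  let hk : ℕ → Ω → ℝ := fun k x => ∫ y in T k, W.toFun x y ∂μ
  have hkm : ∀ k, Measurable (hk k) := fun k =>
    (W.measurable_toFun.stronglyMeasurable.integral_prod_right (ν := μ.restrict (T k))).measurable
  have hk0 : ∀ k x, 0 ≤ hk k x := fun k x => integral_nonneg fun y => W.nonneg x y
  have hk1 : ∀ k x, hk k x ≤ 1 := fun k x => by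
    have := integral_mono (μ := μ.restrict (T k)) (W.integrable_right x).integrableOn
      (integrable_const (1 : ℝ)) (W.le_one x)
    refine this.trans ?_
    simp
  have hi : ∀ {u : Ω → ℝ}, Measurable u → (∀ x, 0 ≤ u x) → (∀ x, u x ≤ 1) → Integrable u μ :=
    fun hu h0 h1 => (memLp_of_unit_interval hu h0 h1).integrable (q := 1) le_rfl
  have hprod : ∀ k, ∫ z in S k ×ˢ T k, W.toFun z.1 z.2 ∂(μ.prod μ) = ∫ x in S k, hk k x ∂μ :=
    fun k => setIntegral_prod _ W.integrable.integrableOn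
  simp_rw [hprod]
  have hpt : ∀ x, Tendsto (fun k => hk k x) atTop (𝓝 (h x)) := fun x =>
    hTg _ (memLp_of_unit_interval (W.measurable_right x) (W.nonneg x) (W.le_one x))
  -- Weak convergence in both factors suffices because integration against `W` upgrades it: the
  -- inner integrals converge pointwise, hence in L¹, so the error is uniform over the sets `S k`.
  have hdiff : Tendsto (fun k => ∫ x, |hk k x - h x| ∂μ) atTop (𝓝 0) := by
    have := tendsto_integral_of_dominated_convergence (μ := μ) (F := fun k x => |hk k x - h x|)
      (f := fun _ => 0) (fun _ => 1) (fun k => ((hkm k).sub hhm).norm.aestronglyMeasurable)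
      (integrable_const 1) (fun k => ae_of_all _ fun x => by
        rw [Real.norm_eq_abs, abs_abs, abs_le]
        constructor <;> linarith [hk0 k x, hk1 k x, hh0 x, hh1 x])
      (ae_of_all _ fun x => by simpa using ((hpt x).sub_const (h x)).abs)
    simpa using this
  have hmain := hSf h (memLp_of_unit_interval hhm hh0 hh1)
  have hz : Tendsto (fun k => ∫ x in S k, hk k x ∂μ - ∫ x in S k, h x ∂μ) atTop (𝓝 0) := by
    refine squeeze_zero_norm (fun k => ?_) hdiff
    rw [← integral_sub (hi (hkm k) (hk0 k) (hk1 k)).integrableOn (hi hhm hh0 hh1).integrableOn]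
    refine (norm_integral_le_integral_norm _).trans ?_
    exact setIntegral_le_integral ((hi (hkm k) (hk0 k) (hk1 k)).sub (hi hhm hh0 hh1)).norm
      (ae_of_all _ fun x => norm_nonneg _)
  simpa using hz.add hmain

/-- The limit is the integral of the nonnegative function f(x)g(y)W(x,y), which must vanish almost
everywhere. -/
theorem Graphon.ae_eq_zero_of_tendsto (W : Graphon Ω)
    (hf : Measurable f) (hf0 : ∀ x, 0 ≤ f x) (hf1 : ∀ x, f x ≤ 1)
    (hg : Measurable g) (hg0 : ∀ x, 0 ≤ g x) (hg1 : ∀ x, g x ≤ 1)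
    (hSf : IsWeakLimit μ S f) (hTg : IsWeakLimit μ T g)
    (h : Tendsto (fun k => ∫ z in S k ×ˢ T k, W.toFun z.1 z.2 ∂(μ.prod μ)) atTop (𝓝 0)) :
    ∀ᵐ z ∂(μ.prod μ), 0 < f z.1 → 0 < g z.2 → W.toFun z.1 z.2 = 0 := by
  have h1 := tendsto_nhds_unique h (W.tendsto_setIntegral_prod hg hg0 hg1 hSf hTg)
  let u : Ω × Ω → ℝ := fun z => f z.1 * (g z.2 * W.toFun z.1 z.2)
  have hu : Measurable u :=
    (hf.comp measurable_fst).mul ((hg.comp measurable_snd).mul W.measurable_toFun)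
  have hu0 : ∀ z, 0 ≤ u z := fun z =>
    mul_nonneg (hf0 _) (mul_nonneg (hg0 _) (W.nonneg _ _))
  have hu1 : ∀ z, u z ≤ 1 := fun z =>
    mul_le_one₀ (hf1 _) (mul_nonneg (hg0 _) (W.nonneg _ _))
      (mul_le_one₀ (hg1 _) (W.nonneg _ _) (W.le_one _ _))
  have hui : Integrable u (μ.prod μ) := (memLp_of_unit_interval hu hu0 hu1).integrable (q := 1) le_rfl
  have h2 : ∫ z, u z ∂(μ.prod μ) = 0 := by
    rw [integral_prod _ hui, h1]
    simp only [u, integral_const_mul]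
  rw [integral_eq_zero_iff_of_nonneg hu0 hui] at h2
  filter_upwards [h2] with z hz hfz hgz
  rcases mul_eq_zero.1 hz with h | h
  · exact absurd h hfz.ne'
  · exact (mul_eq_zero.1 h).resolve_left hgz.ne'

end WeakLimits

end

/-! ### Quantitative connectedness and absence of peninsulas -/

noncomputable section

section Quantitative

variable {Ω : Type*} [MeasurableSpace Ω] {μ : Measure Ω} [IsProbabilityMeasure μ]

theorem integral_le_real_pos {f : Ω → ℝ} (hf : Measurable f) (hf0 : ∀ x, 0 ≤ f x)
    (hf1 : ∀ x, f x ≤ 1) : ∫ x, f x ∂μ ≤ μ.real {x | 0 < f x} := by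
  have hF : MeasurableSet {x | 0 < f x} := measurableSet_lt measurable_const hf
  rw [← integral_indicator_one hF]
  refine integral_mono ((memLp_of_unit_interval hf hf0 hf1).integrable (q := 1) le_rfl)
    ((integrable_const (1 : ℝ)).indicator hF) fun x => ?_
  by_cases hx : 0 < f x
  · simpa [hx] using hf1 x
  · simp [hx, not_lt.1 hx]

theorem Graphon.IsConnected.exists_le_setIntegral [StandardBorelSpace Ω] [NullSingletonClass μ]
    {W : Graphon Ω} (hW : W.IsConnected μ) {β : ℝ} (hβ : 0 < β) :
    ∃ δ : ℝ, 0 < δ ∧ ∀ S : Set Ω, MeasurableSet S → β ≤ μ.real S → β ≤ μ.real Sᶜ →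
      δ ≤ ∫ z in S ×ˢ Sᶜ, W.toFun z.1 z.2 ∂(μ.prod μ) := by
  by_contra! hcon
  choose S hS hSβ hSβ' hlt using fun k : ℕ => hcon (1 / ((k : ℝ) + 1)) Nat.one_div_pos_of_nat
  obtain ⟨f, hf, hf0, hf1, φ, hφ, hlim⟩ := exists_isWeakLimit_comp μ S hS
  have hSm : ∀ k, MeasurableSet ((S ∘ φ) k) := fun k => hS _
  have hlim' := hlim.compl hSm hf hf0 hf1
  have hg : Measurable fun x => 1 - f x := measurable_const.sub hf
  have hg0 : ∀ x, 0 ≤ 1 - f x := fun x => sub_nonneg.2 (hf1 x)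
  have hg1 : ∀ x, 1 - f x ≤ 1 := fun x => by linarith [hf0 x]
  have hz := W.ae_eq_zero_of_tendsto hf hf0 hf1 hg hg0 hg1 hlim hlim' (by
    refine squeeze_zero (fun k => integral_nonneg fun z => W.nonneg _ _)
      (fun k => (hlt (φ k)).le) ?_
    exact tendsto_one_div_add_atTop_nhds_zero_nat.comp hφ.tendsto_atTop)
  have hF : β ≤ μ.real {x | 0 < f x} :=
    (ge_of_tendsto' hlim.tendsto_real fun k => hSβ _).trans (integral_le_real_pos hf hf0 hf1)
  have hG : β ≤ μ.real {x | 0 < 1 - f x} :=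
    (ge_of_tendsto' hlim'.tendsto_real fun k => hSβ' _).trans (integral_le_real_pos hg hg0 hg1)
  have hpos : ∀ {E : Set Ω}, 0 < μ.real E → 0 < μ E := fun h => (ENNReal.toReal_pos_iff.1 h).1
  have hnot : ∀ A : Set Ω, MeasurableSet A → 0 < μ A → 0 < μ Aᶜ →
      ¬ ∀ᵐ z ∂(μ.prod μ), z ∈ A ×ˢ Aᶜ → W.toFun z.1 z.2 = 0 := by
    intro A hA h0 h1 hae
    refine (hW A Aᶜ hA hA.compl disjoint_compl_right (union_compl_self A) h0 h1).ne' ?_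
    exact setIntegral_eq_zero_of_ae_eq_zero hae
  have hFm : MeasurableSet {x | 0 < f x} := measurableSet_lt measurable_const hf
  have hGm : MeasurableSet {x | 0 < 1 - f x} := measurableSet_lt measurable_const hg
  have hFpos := hpos (hβ.trans_le hF)
  have hGpos := hpos (hβ.trans_le hG)
  -- `W` vanishes on {f > 0} × {f < 1}. If {f = 0} or {f = 1} has positive measure, it and its
  -- complement disconnect `W`; otherwise `W = 0` almost everywhere and any half of Ω does.
  by_cases hFc : 0 < μ {x | 0 < f x}ᶜ
  · refine hnot _ hFm hFpos hFc ?_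
    filter_upwards [hz] with z h1 h2
    refine h1 h2.1 ?_
    have h3 : ¬ 0 < f z.2 := h2.2
    linarith [hf0 z.2]
  have hFae : ∀ᵐ x ∂μ, 0 < f x := by
    rw [ae_iff]; exact nonpos_iff_eq_zero.1 (not_lt.1 hFc)
  have hz' : ∀ᵐ z ∂(μ.prod μ), 0 < 1 - f z.2 → W.toFun z.1 z.2 = 0 := by
    filter_upwards [hz, Measure.quasiMeasurePreserving_fst.ae hFae] with z h1 h2 using h1 h2
  by_cases hGc : 0 < μ {x | 0 < 1 - f x}ᶜ
  · refine hnot _ hGm.compl hGc (by rwa [compl_compl]) ?_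
    rw [compl_compl]
    filter_upwards [hz'] with z h1 h2 using h1 h2.2
  have hGae : ∀ᵐ x ∂μ, 0 < 1 - f x := by
    rw [ae_iff]; exact nonpos_iff_eq_zero.1 (not_lt.1 hGc)
  obtain ⟨A, -, hA, hAa⟩ := exists_measurableSet_subset_real_eq μ (S := univ) .univ
    (a := 1 / 2) (by norm_num) (by simp; norm_num)
  refine hnot A hA (hpos (by rw [hAa]; norm_num))
    (hpos (by rw [probReal_compl_eq_one_sub hA, hAa]; norm_num)) ?_
  filter_upwards [hz', Measure.quasiMeasurePreserving_snd.ae hGae] with z h1 h2 _ using h1 h2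

theorem Graphon.exists_le_setIntegral_of_not_hasPeninsula [StandardBorelSpace Ω]
    [NullSingletonClass μ] {W : Graphon Ω} (hW : ¬ W.HasPeninsula μ) {β : ℝ} (hβ : 0 < β) :
    ∃ δ : ℝ, 0 < δ ∧ ∀ S T : Set Ω, MeasurableSet S → MeasurableSet T → S ⊆ T → β ≤ μ.real S →
      1 - μ.real S - δ ≤ μ.real T → δ ≤ ∫ z in S ×ˢ T, W.toFun z.1 z.2 ∂(μ.prod μ) := by
  by_contra! hcon
  choose S T hS hT hST hSβ hTμ hlt using
    fun k : ℕ => hcon (1 / ((k : ℝ) + 1)) Nat.one_div_pos_of_nat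
  obtain ⟨f, hf, hf0, hf1, φ, hφ, hlimφ⟩ := exists_isWeakLimit_comp μ S hS
  obtain ⟨g, hg, hg0, hg1, ψ, hψ, hlimT⟩ := exists_isWeakLimit_comp μ (T ∘ φ) fun k => hT _
  have hlimS := hlimφ.comp hψ
  have htop : Tendsto (fun k : ℕ => 1 / (((φ (ψ k) : ℕ) : ℝ) + 1)) atTop (𝓝 0) :=
    tendsto_one_div_add_atTop_nhds_zero_nat.comp (hφ.comp hψ).tendsto_atTop
  have hz := W.ae_eq_zero_of_tendsto hf hf0 hf1 hg hg0 hg1 hlimS hlimT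
    (squeeze_zero (fun k => integral_nonneg fun z => W.nonneg _ _)
      (fun k => (hlt (φ (ψ k))).le) htop)
  have hfi : Integrable f μ := (memLp_of_unit_interval hf hf0 hf1).integrable (q := 1) le_rfl
  have hgi : Integrable g μ := (memLp_of_unit_interval hg hg0 hg1).integrable (q := 1) le_rfl
  have hfg : ∀ᵐ x ∂μ, f x ≤ g x := hlimS.ae_le hfi hgi hlimT fun k => hST _
  have hfβ : β ≤ ∫ x, f x ∂μ := ge_of_tendsto' hlimS.tendsto_real fun k => hSβ _
  have hsum : 1 - ∫ x, f x ∂μ ≤ ∫ x, g x ∂μ := by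
    have h1 := (hlimS.tendsto_real.const_sub 1).sub htop
    rw [sub_zero] at h1
    exact le_of_tendsto_of_tendsto' h1 hlimT.tendsto_real fun k => hTμ _
  set F : Set Ω := {x | 0 < f x}
  set G : Set Ω := {x | 0 < g x}
  have hFm : MeasurableSet F := measurableSet_lt measurable_const hf
  have hGm : MeasurableSet G := measurableSet_lt measurable_const hg
  have hF := integral_le_real_pos (μ := μ) hf hf0 hf1
  have hG := integral_le_real_pos (μ := μ) hg hg0 hg1
  have hzero : ∀ A B : Set Ω, A ⊆ F → B ⊆ G →
      ∀ᵐ z ∂(μ.prod μ), z ∈ A ×ˢ (A ∪ B) → W.toFun z.1 z.2 = 0 := by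
    intro A B hA hB
    filter_upwards [hz, Measure.quasiMeasurePreserving_snd.ae hfg] with z h1 h2 h3
    refine h1 (hA h3.1) ?_
    rcases h3.2 with h | h
    · exact lt_of_lt_of_le (hA h) h2
    · exact hB h
  apply hW
  -- Up to null sets F ⊆ G, their measures sum to at least 1, and `W` vanishes on F × G. The
  -- peninsula is F with part of G \ F, or half the space inside F.
  by_cases hF2 : μ.real F ≤ 1 / 2
  · have hd : 1 - 2 * μ.real F ≤ μ.real (G \ F) := by
      have := le_measureReal_sdiff (μ := μ) (s₁ := G) (s₂ := F)
      linarith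
    obtain ⟨B, hB, hBm, hBa⟩ := exists_measurableSet_subset_real_eq μ (hGm.diff hFm)
      (by linarith) hd
    exact ⟨μ.real F, by linarith, hF2, F, B, hFm, hBm,
      disjoint_sdiff_right.mono_right hB, rfl, hBa,
      hzero F B Subset.rfl (hB.trans sdiff_subset)⟩
  · obtain ⟨A, hA, hAm, hAa⟩ := exists_measurableSet_subset_real_eq μ hFm
      (a := 1 / 2) (by norm_num) (not_le.1 hF2).le
    exact ⟨1 / 2, by norm_num, le_rfl, A, ∅, hAm, .empty, disjoint_empty _, hAa,
      by norm_num, hzero A ∅ hA (empty_subset _)⟩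

end Quantitative

end

/-! ### Transfer between weighted graphs and graphons -/

noncomputable section

section Representation

variable {Ω : Type*} [MeasurableSpace Ω] {μ : Measure Ω} [IsProbabilityMeasure μ]

theorem abs_setIntegral_le_cutNorm {F : Ω → Ω → ℝ} (hF : ∀ x y, |F x y| ≤ 1) {S T : Set Ω}
    (hS : MeasurableSet S) (hT : MeasurableSet T) :
    |∫ z in S ×ˢ T, F z.1 z.2 ∂(μ.prod μ)| ≤ cutNorm μ F := by
  -- Boundedness is essential: the real `sSup` of an unbounded set is 0.
  refine le_csSup ⟨1, ?_⟩ ⟨S, T, hS, hT, rfl⟩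
  rintro r ⟨S, T, -, -, rfl⟩
  have := norm_setIntegral_le_of_norm_le_const (μ := μ.prod μ) (s := S ×ˢ T)
    (f := fun z => F z.1 z.2) (C := 1) (measure_lt_top _ _) fun z _ => hF z.1 z.2
  rw [one_mul] at this
  exact this.trans measureReal_le_one

/-- A partition witnessing that the cut distance of `R` from `W` is less than `ε` turns upper bounds
on the weights sent between vertex sets of `R` into upper bounds on integrals of `W`. -/
theorem WeightedGraph.CutDistLT.exists_partition {V : Type*} [Fintype V] {R : WeightedGraph V}
    {W : Graphon Ω} {ε : ℝ} (h : R.CutDistLT μ W ε) :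
    0 < Nat.card V ∧ ∃ c : Ω → V, (∀ X : Set V, MeasurableSet (c ⁻¹' X)) ∧
      (∀ X : Finset V, μ.real (c ⁻¹' X) = X.card / (Nat.card V : ℝ)) ∧
      ∀ (X Y : Finset V) (d : ℝ), (∀ u ∈ X, ∑ v ∈ Y, R.weight u v ≤ d * Nat.card V) →
        ∫ z in (c ⁻¹' X) ×ˢ (c ⁻¹' Y), W.toFun z.1 z.2 ∂(μ.prod μ) <
          d * (X.card / (Nat.card V : ℝ)) + ε := by
  obtain ⟨U, ⟨c, hcm, hcμ, hU⟩, hcut⟩ := h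
  obtain ⟨x₀⟩ : Nonempty Ω := μ.nonempty_of_neZero
  have : Nonempty V := ⟨c x₀⟩
  have hn : 0 < Nat.card V := Nat.card_pos
  have hn' : (0 : ℝ) < Nat.card V := by exact_mod_cast hn
  -- With the discrete σ-algebra on the finite set V, measurable fibres make `c` measurable.
  let mV : MeasurableSpace V := ⊤
  have hc : Measurable c := measurable_to_countable' hcm
  have hX : ∀ X : Set V, MeasurableSet (c ⁻¹' X) := fun X => hc trivial
  have hsplit : ∀ (Y : Finset V) (k : V → ℝ),
      ∫ y in c ⁻¹' Y, k (c y) ∂μ = ∑ v ∈ Y, k v * (1 / (Nat.card V : ℝ)) := by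
    intro Y k
    have hun : c ⁻¹' (Y : Set V) = ⋃ v ∈ Y, c ⁻¹' {v} := by ext; simp
    have hk : Integrable (fun y => k (c y)) μ := by
      obtain ⟨B, hB⟩ := (finite_range fun v => ‖k v‖).bddAbove
      refine Integrable.of_bound (C := B)
        ((measurable_from_top (f := k)).comp hc).aestronglyMeasurable
        (ae_of_all _ fun y => hB ⟨c y, rfl⟩)
    rw [hun, integral_biUnion_finset Y (fun v _ => hcm v) ?_ fun v _ => hk.integrableOn]
    · refine Finset.sum_congr rfl fun v _ => ?_
      rw [setIntegral_congr_fun (g := fun _ => k v) (hcm v) (fun y hy => by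
        have : c y = v := hy
        simp only [this]), setIntegral_const, hcμ, smul_eq_mul, mul_comm]
    · intro v _ w _ hvw
      exact Disjoint.preimage c (disjoint_singleton.2 hvw)
  have hUm : Measurable fun z : Ω × Ω => U z.1 z.2 := by
    simp_rw [hU]
    exact (measurable_of_countable (Function.uncurry R.weight)).comp
      ((hc.comp measurable_fst).prodMk (hc.comp measurable_snd))
  have hU0 : ∀ x y, 0 ≤ U x y := fun x y => hU x y ▸ R.weight_nonneg _ _
  have hU1 : ∀ x y, U x y ≤ 1 := fun x y => hU x y ▸ R.weight_le_one _ _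
  have hUi : Integrable (fun z : Ω × Ω => U z.1 z.2) (μ.prod μ) :=
    (memLp_of_unit_interval hUm (fun z => hU0 z.1 z.2) fun z => hU1 z.1 z.2).integrable
      (q := 1) le_rfl
  refine ⟨hn, c, hX, fun X => ?_, fun X Y d hd => ?_⟩
  · have := hsplit X fun _ => 1
    simpa [div_eq_mul_inv] using this
  · have hUXY : ∫ z in (c ⁻¹' X) ×ˢ (c ⁻¹' Y), U z.1 z.2 ∂(μ.prod μ) ≤
        d * (X.card / (Nat.card V : ℝ)) := by
      rw [setIntegral_prod _ hUi.integrableOn]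
      simp_rw [hU]
      rw [setIntegral_congr_fun (hX X) fun x _ => hsplit Y (R.weight (c x)),
        hsplit X fun u => ∑ v ∈ Y, R.weight u v * (1 / (Nat.card V : ℝ))]
      have : ∀ u ∈ X, (∑ v ∈ Y, R.weight u v * (1 / (Nat.card V : ℝ))) * (1 / (Nat.card V : ℝ)) ≤
          d * (1 / (Nat.card V : ℝ)) := by
        intro u hu
        refine mul_le_mul_of_nonneg_right ?_ (by positivity)
        rw [← Finset.sum_mul, mul_one_div, div_le_iff₀ hn']
        exact hd u hu
      refine (Finset.sum_le_sum this).trans (le_of_eq ?_)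
      rw [Finset.sum_const, nsmul_eq_mul]
      ring
    have hle := (le_abs_self _).trans (abs_setIntegral_le_cutNorm (μ := μ)
      (F := fun x y => W.toFun x y - U x y) (fun x y => by
        rw [abs_le]
        constructor <;> linarith [hU0 x y, hU1 x y, W.nonneg x y, W.le_one x y])
      (hX X) (hX Y))
    rw [integral_sub W.integrable.integrableOn hUi.integrableOn] at hle
    linarith

/-- A set of small average degree is small if few points have small degree. -/
theorem Graphon.real_le_of_setIntegral_le (W : Graphon Ω) {S : Set Ω} (hS : MeasurableSet S)
    {d ε : ℝ} (hd : 0 < d)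
    (h : ∫ z in S ×ˢ univ, W.toFun z.1 z.2 ∂(μ.prod μ) ≤ d * μ.real S + ε) :
    μ.real S ≤ 2 * μ.real (W.lowDeg μ (2 * d)) + ε / d := by
  have hdegm : Measurable (W.deg μ) :=
    (W.measurable_toFun.stronglyMeasurable.integral_prod_right (ν := μ)).measurable
  have hdeg0 : ∀ x, 0 ≤ W.deg μ x := fun x => integral_nonneg fun y => W.nonneg x y
  have hdeg1 : ∀ x, W.deg μ x ≤ 1 := fun x => by
    have := integral_mono (μ := μ) (W.integrable_right x) (integrable_const (1 : ℝ)) (W.le_one x)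
    simpa [Graphon.deg] using this
  have hi : Integrable (W.deg μ) μ :=
    (memLp_of_unit_interval hdegm hdeg0 hdeg1).integrable (q := 1) le_rfl
  have hL : MeasurableSet (W.lowDeg μ (2 * d)) := measurableSet_le hdegm measurable_const
  rw [setIntegral_prod _ W.integrable.integrableOn] at h
  simp only [Measure.restrict_univ] at h
  -- Markov: points of `S` outside the low-degree set have degree above 2d.
  have h1 : 2 * d * μ.real (S \ W.lowDeg μ (2 * d)) ≤ ∫ x in S, W.deg μ x ∂μ := by
    refine le_trans ?_ (setIntegral_mono_set hi.integrableOn (ae_of_all _ hdeg0)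
      (sdiff_subset (s := S) (t := W.lowDeg μ (2 * d))).eventuallyLE)
    have := setIntegral_mono_on (μ := μ) (f := fun _ => 2 * d)
      (integrable_const (2 * d)).integrableOn hi.integrableOn (hS.diff hL)
      fun x hx => (not_le.1 hx.2).le
    rw [setIntegral_const, smul_eq_mul, mul_comm] at this
    exact this
  have h2 := le_measureReal_sdiff (μ := μ) (s₁ := S) (s₂ := W.lowDeg μ (2 * d))
  have h3 := mul_le_mul_of_nonneg_left h2 (by positivity : 0 ≤ 2 * d)
  have h4 : 2 * d * (μ.real S - μ.real (W.lowDeg μ (2 * d))) ≤ d * μ.real S + ε :=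
    h3.trans (h1.trans h)
  have h5 : d * (ε / d) = ε := by field_simp
  refine le_of_mul_le_mul_left ?_ hd
  linarith

end Representation

end

/-! ### Small vertex sets, connectedness and half-covers -/

noncomputable section

section Main

theorem WeightedGraph.sum_weight_le_card {V : Type*} (R : WeightedGraph V) {Y Z : Finset V} {u : V}
    (h : ∀ v ∈ Y, v ∉ Z → R.weight u v = 0) : ∑ v ∈ Y, R.weight u v ≤ Z.card := by
  classical
  calc ∑ v ∈ Y, R.weight u v = ∑ v ∈ Y.filter (· ∈ Z), R.weight u v := by
        refine (Finset.sum_filter_of_ne fun v hv hne => ?_).symm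
        by_contra hZ
        exact hne (h v hv hZ)
    _ ≤ ∑ v ∈ Y.filter (· ∈ Z), (1 : ℝ) := Finset.sum_le_sum fun v _ => R.weight_le_one u v
    _ ≤ Z.card := by
        rw [Finset.sum_const, nsmul_eq_mul, mul_one]
        exact_mod_cast Finset.card_le_card fun v hv => (Finset.mem_filter.1 hv).2

variable {Ω : Type*} [MeasurableSpace Ω] {μ : Measure Ω} [IsProbabilityMeasure μ] {W : Graphon Ω}
  {V : Type*} [Fintype V] {R : WeightedGraph V} {ε α t₀ : ℝ}

/-- Markov with d = α: the tail contributes 2 · (γ/8) · 2α = γα/2 and the cut error ε/α at most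
γα/2. -/
theorem WeightedGraph.CutDistLT.ncard_lowDeg_le (h : R.CutDistLT μ W ε) (hα : 0 < α) {γ : ℝ}
    (ht : μ.real (W.lowDeg μ (2 * α)) ≤ γ / 8 * (2 * α)) (hε : ε ≤ γ * α ^ 2 / 2) :
    ((R.lowDeg α).ncard : ℝ) ≤ γ * α * Nat.card V := by
  classical
  obtain ⟨hn, c, hc, hcμ, hcut⟩ := h.exists_partition
  have hn' : (0 : ℝ) < Nat.card V := by exact_mod_cast hn
  set X : Finset V := (R.lowDeg α).toFinset with hX
  have hint := hcut X Finset.univ α fun u hu => by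
    have hmem : u ∈ R.lowDeg α := mem_toFinset.1 hu
    have hu' : R.deg u < α * Nat.card V := hmem
    rw [WeightedGraph.deg, finsum_eq_sum_of_fintype] at hu'
    simpa only [R.weight_symm u] using hu'.le
  rw [Finset.coe_univ, preimage_univ, ← hcμ] at hint
  have hs := W.real_le_of_setIntegral_le (hc X) hα hint.le
  have hεα : ε / α ≤ γ * α / 2 := by
    rw [div_le_iff₀ hα]; nlinarith
  rw [hcμ] at hs
  rw [ncard_eq_toFinset_card', ← div_le_iff₀ hn', ← hX]
  linarith

/-- A set of vertices of large degree whose neighbourhood is hardly larger than the set itself is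
not too small. -/
theorem WeightedGraph.CutDistLT.le_card_div (h : R.CutDistLT μ W ε) (hα : 0 < α)
    (ht : ∀ t, 0 < t → t < t₀ → μ.real (W.lowDeg μ t) ≤ t / 16) (hε : ε ≤ α ^ 2 / 40)
    {X N : Finset V} (hX : X.Nonempty) (hdeg : ∀ u ∈ X, α * Nat.card V ≤ ∑ v, R.weight u v)
    (hN : ∀ u ∈ X, ∀ v, v ∉ N → R.weight u v = 0)
    (hNX : (N.card : ℝ) ≤ X.card + α / 10 * Nat.card V) :
    t₀ / 8 ≤ X.card / (Nat.card V : ℝ) := by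
  obtain ⟨hn, c, hc, hcμ, hcut⟩ := h.exists_partition
  have hn' : (0 : ℝ) < Nat.card V := by exact_mod_cast hn
  by_contra! hlt
  set s : ℝ := X.card / (Nat.card V : ℝ) with hs
  have hXs : (X.card : ℝ) = s * Nat.card V := by rw [hs]; field_simp
  have hub : ∀ u ∈ X, ∑ v, R.weight u v ≤ (s + α / 10) * Nat.card V := by
    intro u hu
    refine (R.sum_weight_le_card fun v _ => hN u hu v).trans (hNX.trans (le_of_eq ?_))
    rw [hXs]; ring
  obtain ⟨u, hu⟩ := hX
  have hαs : α ≤ s + α / 10 := le_of_mul_le_mul_right ((hdeg u hu).trans (hub u hu)) hn'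
  have hint := hcut X Finset.univ _ hub
  rw [Finset.coe_univ, preimage_univ, ← hcμ X] at hint
  have hd : 0 < s + α / 10 := hα.trans_le hαs
  have hle := W.real_le_of_setIntegral_le (hc X) hd hint.le
  rw [hcμ X, ← hs] at hle
  -- Here α ≤ (10/9)s and s < t₀/8 keep the argument below t₀. The resulting s ≤ (s + α/10)/4 + α/40
  -- contradicts s ≥ 9α/10.
  have hlow := ht (2 * (s + α / 10)) (by linarith) (by linarith)
  have hεd : ε / (s + α / 10) ≤ α / 40 := by
    rw [div_le_iff₀ hd]
    nlinarith
  linarith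

variable {V' : Type*} [Fintype V'] {G : SimpleGraph V'} {ι : V' ↪ V}

theorem WeightedGraph.CutDistLT.le_card_div_of_embedding (h : R.CutDistLT μ W ε) (hα : 0 < α)
    (ht : ∀ t, 0 < t → t < t₀ → μ.real (W.lowDeg μ t) ≤ t / 16) (hε : ε ≤ α ^ 2 / 40)
    (hdeg : ∀ a, α * Nat.card V ≤ ∑ v, R.weight (ι a) v)
    (hG : ∀ a b, ¬ G.Adj a b → R.weight (ι a) (ι b) = 0)
    (hcard : (Nat.card V : ℝ) ≤ Nat.card V' + α / 10 * Nat.card V)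
    {X Y : Finset V'} (hX : X.Nonempty) (hXY : ∀ a ∈ X, ∀ b, G.Adj a b → b ∈ Y)
    (hYX : Y.card ≤ X.card) : t₀ / 8 ≤ X.card / (Nat.card V : ℝ) := by
  classical
  -- Deleted vertices may be neighbours of X in `R`, so all of them, at most αn/10, are added to N.
  rw [← Finset.card_map ι]
  refine h.le_card_div hα ht hε (N := Y.map ι ∪ (Finset.univ.map ι)ᶜ) (hX.map) ?_ ?_ ?_
  · intro u hu
    obtain ⟨a, -, rfl⟩ := Finset.mem_map.1 hu
    exact hdeg a
  · intro u hu v hv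
    obtain ⟨a, ha, rfl⟩ := Finset.mem_map.1 hu
    simp only [Finset.mem_union, Finset.mem_compl, not_or, not_not] at hv
    obtain ⟨b, -, rfl⟩ := Finset.mem_map.1 hv.2
    exact hG a b fun hab => hv.1 (Finset.mem_map_of_mem ι (hXY a ha b hab))
  · have h1 := Finset.card_union_le (Y.map ι) (Finset.univ.map ι)ᶜ
    have h2 := Finset.card_add_card_compl (Finset.univ.map ι)
    rw [Finset.card_map] at h1 h2 ⊢
    rw [Finset.card_univ, ← Nat.card_eq_fintype_card, ← Nat.card_eq_fintype_card] at h2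
    have h1' : ((Y.map ι ∪ (Finset.univ.map ι)ᶜ).card : ℝ) ≤
      Y.card + ((Finset.univ.map ι)ᶜ : Finset V).card := by exact_mod_cast h1
    have h2' : (Nat.card V' : ℝ) + ((Finset.univ.map ι)ᶜ : Finset V).card = Nat.card V := by
      exact_mod_cast h2
    have h3 : (Y.card : ℝ) ≤ X.card := by exact_mod_cast hYX
    linarith

/-- A component and its complement are both closed under adjacency, hence both large. Only deleted
vertices carry weight across the cut, which gives `W`-mass below α/10 + ε < δ. -/
theorem WeightedGraph.CutDistLT.connected_of_embedding {δ : ℝ} (h : R.CutDistLT μ W ε)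
    (hα : 0 < α) (hα1 : α ≤ 1)
    (ht : ∀ t, 0 < t → t < t₀ → μ.real (W.lowDeg μ t) ≤ t / 16) (hε : ε ≤ α ^ 2 / 40)
    (hdeg : ∀ a, α * Nat.card V ≤ ∑ v, R.weight (ι a) v)
    (hG : ∀ a b, ¬ G.Adj a b → R.weight (ι a) (ι b) = 0)
    (hcard : (Nat.card V : ℝ) ≤ Nat.card V' + α / 10 * Nat.card V) (hδ : α ≤ δ)
    (hW : ∀ S : Set Ω, MeasurableSet S → t₀ / 8 ≤ μ.real S → t₀ / 8 ≤ μ.real Sᶜ →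
      δ ≤ ∫ z in S ×ˢ Sᶜ, W.toFun z.1 z.2 ∂(μ.prod μ)) : G.Connected := by
  classical
  obtain ⟨hn, c, hc, hcμ, hcut⟩ := h.exists_partition
  have hn' : (0 : ℝ) < Nat.card V := by exact_mod_cast hn
  have : Nonempty V' := by
    have : (0 : ℝ) < Nat.card V' := by nlinarith
    exact (Nat.card_pos_iff.1 (by exact_mod_cast this)).1
  refine (SimpleGraph.connected_iff G).2 ⟨fun a b => ?_, this⟩
  by_contra hab
  set X : Finset V' := Finset.univ.filter (G.Reachable a) with hX
  have hXmem : ∀ v, v ∈ X ↔ G.Reachable a v := fun v => by simp [hX]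
  have hXX : ∀ v w, G.Adj v w → (v ∈ X ↔ w ∈ X) := fun v w hvw => by
    rw [hXmem, hXmem]
    exact ⟨fun h => h.trans hvw.reachable, fun h => h.trans hvw.symm.reachable⟩
  have h1 := h.le_card_div_of_embedding hα ht hε hdeg hG hcard (X := X) (Y := X)
    ⟨a, (hXmem a).2 (.refl a)⟩ (fun v hv w hvw => (hXX v w hvw).1 hv) le_rfl
  have h2 := h.le_card_div_of_embedding hα ht hε hdeg hG hcard (X := Xᶜ) (Y := Xᶜ)
    ⟨b, by rwa [Finset.mem_compl, hXmem]⟩ (fun v hv w hvw => by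
      rwa [Finset.mem_compl, ← hXX v w hvw, ← Finset.mem_compl]) le_rfl
  have hcompl : (c ⁻¹' (X.map ι : Finset V))ᶜ = c ⁻¹' ((X.map ι)ᶜ : Finset V) := by
    rw [Finset.coe_compl, preimage_compl]
  have hQcard : (((Finset.univ.map ι)ᶜ : Finset V).card : ℝ) ≤ α / 10 * Nat.card V := by
    have h2 := Finset.card_add_card_compl (Finset.univ.map ι)
    rw [Finset.card_map, Finset.card_univ, ← Nat.card_eq_fintype_card,
      ← Nat.card_eq_fintype_card] at h2
    have h2' : (Nat.card V' : ℝ) + ((Finset.univ.map ι)ᶜ : Finset V).card = Nat.card V := by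
      exact_mod_cast h2
    linarith
  have hint := hcut (X.map ι) (X.map ι)ᶜ (α / 10) fun u hu => by
    obtain ⟨v, hv, rfl⟩ := Finset.mem_map.1 hu
    refine le_trans (R.sum_weight_le_card fun w hw hwQ => ?_) hQcard
    rw [Finset.mem_compl, not_not] at hwQ
    obtain ⟨w, -, rfl⟩ := Finset.mem_map.1 hwQ
    refine hG v w fun hvw => Finset.mem_compl.1 hw ?_
    exact Finset.mem_map_of_mem ι ((hXX v w hvw).1 hv)
  have hlow := hW (c ⁻¹' (X.map ι : Finset V)) (hc _) (by rwa [hcμ, Finset.card_map]) (by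
    rw [hcompl, hcμ]
    refine h2.trans (div_le_div_of_nonneg_right ?_ hn'.le)
    rw [← Finset.card_map ι]
    refine Nat.cast_le.2 (Finset.card_le_card fun v hv => ?_)
    obtain ⟨w, hw, rfl⟩ := Finset.mem_map.1 hv
    rw [Finset.mem_compl, Finset.mem_map' ι]
    exact Finset.mem_compl.1 hw)
  rw [hcompl] at hlow
  have hX1 : ((X.map ι).card : ℝ) / Nat.card V ≤ 1 := by
    rw [← hcμ]; exact measureReal_le_one
  nlinarith

/-- For X = {f = 0} and Y = {f = 1}, no edge joins X to the complement of Y, which contains X. As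
|Y| ≤ |X|, this is almost a peninsula. -/
theorem WeightedGraph.CutDistLT.isUniquelyHalfCovered_of_embedding {δ : ℝ}
    (h : R.CutDistLT μ W ε) (hα : 0 < α)
    (ht : ∀ t, 0 < t → t < t₀ → μ.real (W.lowDeg μ t) ≤ t / 16) (hε : ε ≤ α ^ 2 / 40)
    (hdeg : ∀ a, α * Nat.card V ≤ ∑ v, R.weight (ι a) v)
    (hG : ∀ a b, ¬ G.Adj a b → R.weight (ι a) (ι b) = 0)
    (hcard : (Nat.card V : ℝ) ≤ Nat.card V' + α / 10 * Nat.card V) (hδ : α ≤ δ) (hεδ : ε ≤ δ)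
    (hW : ∀ S T : Set Ω, MeasurableSet S → MeasurableSet T → S ⊆ T → t₀ / 8 ≤ μ.real S →
      1 - μ.real S - δ ≤ μ.real T → δ ≤ ∫ z in S ×ˢ T, W.toFun z.1 z.2 ∂(μ.prod μ)) :
    IsUniquelyHalfCovered G := by
  classical
  intro f
  constructor
  swap
  · rintro rfl
    refine ⟨⟨fun v => by simp, fun u v _ => by norm_num⟩, ?_⟩
    rw [finsum_eq_sum_of_fintype, Finset.sum_const, nsmul_eq_mul, Finset.card_univ,
      Nat.card_eq_fintype_card]
    linarith
  rintro ⟨⟨hf, hcov⟩, hsum⟩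
  set X : Finset V' := Finset.univ.filter (f · = 0) with hX
  set Y : Finset V' := Finset.univ.filter (f · = 1) with hY
  have hXmem : ∀ v, v ∈ X ↔ f v = 0 := fun v => by simp [hX]
  have hYmem : ∀ v, v ∈ Y ↔ f v = 1 := fun v => by simp [hY]
  have hYX : Y.card ≤ X.card := by
    -- The excess of `f` over 1/2 sums to (|Y| − |X|)/2.
    have h1 : ∑ v, f v = ∑ v : V', ((1 / 2 : ℝ) + (if f v = 1 then 1 / 2 else 0)
        - (if f v = 0 then 1 / 2 else 0)) := by
      refine Finset.sum_congr rfl fun v _ => ?_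
      rcases hf v with h | h | h <;> norm_num [h]
    rw [finsum_eq_sum_of_fintype, h1, Finset.sum_sub_distrib, Finset.sum_add_distrib,
      ← Finset.sum_filter, ← Finset.sum_filter, ← hX, ← hY] at hsum
    simp only [Finset.sum_const, nsmul_eq_mul, Finset.card_univ,
      ← Nat.card_eq_fintype_card] at hsum
    have : (Y.card : ℝ) ≤ X.card := by linarith
    exact_mod_cast this
  have hnbr : ∀ a ∈ X, ∀ b, G.Adj a b → b ∈ Y := by
    intro a ha b hab
    have h1 := hcov a b hab
    rw [(hXmem a).1 ha] at h1
    rw [hYmem]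
    rcases hf b with h | h | h <;> first | exact h | (rw [h] at h1; norm_num at h1)
  rcases X.eq_empty_or_nonempty with hX0 | hXne
  · have hY0 : Y = ∅ := by simpa [hX0] using hYX
    ext v
    rcases hf v with h | h | h
    · rw [← hXmem, hX0] at h; simp at h
    · exact h
    · rw [← hYmem, hY0] at h; simp at h
  exfalso
  have hβ := h.le_card_div_of_embedding hα ht hε hdeg hG hcard hXne hnbr hYX
  obtain ⟨hn, c, hc, hcμ, hcut⟩ := h.exists_partition
  have hn' : (0 : ℝ) < Nat.card V := by exact_mod_cast hn
  have hint := hcut (X.map ι) (Yᶜ.map ι) 0 fun u hu => by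
    obtain ⟨v, hv, rfl⟩ := Finset.mem_map.1 hu
    rw [zero_mul]
    refine (Finset.sum_eq_zero fun w hw => ?_).le
    obtain ⟨w, hw', rfl⟩ := Finset.mem_map.1 hw
    exact hG v w fun hvw => Finset.mem_compl.1 hw' (hnbr v hv w hvw)
  rw [zero_mul, zero_add] at hint
  refine absurd hint (not_lt.2 (hεδ.trans (hW _ _ (hc _) (hc _) ?_ ?_ ?_)))
  · refine preimage_mono (Finset.coe_subset.2 (Finset.map_subset_map.2 fun v hv => ?_))
    rw [Finset.mem_compl, hYmem, (hXmem v).1 hv]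
    norm_num
  · rwa [hcμ, Finset.card_map]
  · have h1 := Finset.card_add_card_compl Y
    rw [← Nat.card_eq_fintype_card] at h1
    have h1' : (Y.card : ℝ) + (Yᶜ : Finset V').card = Nat.card V' := by exact_mod_cast h1
    have h2 : (Y.card : ℝ) ≤ X.card := by exact_mod_cast hYX
    have h3 : (1 - α / 10) - X.card / (Nat.card V : ℝ) ≤
        (Yᶜ : Finset V').card / (Nat.card V : ℝ) := by
      rw [sub_le_iff_le_add, ← add_div, le_div_iff₀ hn']
      linarith
    rw [hcμ, hcμ, Finset.card_map, Finset.card_map]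
    linarith

end Main

end

/-! ### Choice of constants -/

theorem proposition4p2 {Ω : Type*} [MeasurableSpace Ω] [StandardBorelSpace Ω]
    (μ : Measure Ω) [IsProbabilityMeasure μ] [NullSingletonClass μ] (W : Graphon Ω)
    (h_conn : W.IsConnected μ) (h_tail : W.HasLightTail μ) (h_pen : ¬ W.HasPeninsula μ)
    (C γ : ℝ) (hC : 1 < C) (hγ0 : 0 < γ) (hγ : γ < 1 / (20 * C)) :
    ∃ ε α₀ : ℝ, 0 < ε ∧ ε ≤ 1 ∧ 0 < α₀ ∧ α₀ ≤ 1 ∧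
      ∀ (V : Type*) [Finite V] (R : WeightedGraph V), R.CutDistLT μ W ε →
        ((R.lowDeg α₀).ncard : ℝ) ≤ γ * α₀ * Nat.card V ∧
        ∀ A : Set ((R.lowDeg α₀)ᶜ : Set V), (A.ncard : ℝ) ≤ C * γ * α₀ * Nat.card V →
          IsUniquelyHalfCovered ((R.deleteVerts (R.lowDeg α₀)).deleteVerts A).graph ∧
          ((R.deleteVerts (R.lowDeg α₀)).deleteVerts A).graph.Connected := by
  have hCγ : C * γ < 1 / 20 := by
    rw [lt_div_iff₀ (by linarith)] at hγ
    linarith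
  have hγ1 : γ < 1 / 20 := by nlinarith
  obtain ⟨t₀, ht₀, ht⟩ : ∃ t₀ : ℝ, 0 < t₀ ∧ ∀ t, 0 < t → t < t₀ →
      μ.real (W.lowDeg μ t) ≤ γ / 8 * t := by
    have h1 := h_tail.eventually (gt_mem_nhds (show (0 : ℝ) < γ / 8 by linarith))
    obtain ⟨t₀, ht₀, hsub⟩ := mem_nhdsGT_iff_exists_Ioo_subset.1 h1
    refine ⟨t₀, ht₀, fun t h0 hlt => ?_⟩
    have h2 : μ.real (W.lowDeg μ t) / t < γ / 8 := hsub ⟨h0, hlt⟩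
    exact ((div_lt_iff₀ h0).1 h2).le
  have ht16 : ∀ t, 0 < t → t < t₀ → μ.real (W.lowDeg μ t) ≤ t / 16 := fun t h0 hlt => by
    have := ht t h0 hlt
    nlinarith
  have hβ : 0 < t₀ / 8 := by linarith
  obtain ⟨δ₁, hδ₁, hW₁⟩ := h_conn.exists_le_setIntegral hβ
  obtain ⟨δ₂, hδ₂, hW₂⟩ := Graphon.exists_le_setIntegral_of_not_hasPeninsula h_pen hβ
  -- The tail fixes t₀, compactness at β = t₀/8 fixes δ₁ and δ₂, and only then are α and finally ε
  -- chosen.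
  obtain ⟨α, hα, hα1, hαt, hαδ₁, hαδ₂⟩ : ∃ α : ℝ, 0 < α ∧ α ≤ 1 ∧ 2 * α < t₀ ∧ α ≤ δ₁ ∧ α ≤ δ₂ :=
    ⟨min (min 1 (t₀ / 4)) (min δ₁ δ₂), by positivity, by simp,
      by linarith [(min_le_left (min 1 (t₀ / 4)) (min δ₁ δ₂)).trans (min_le_right _ _)],
      by simp, by simp⟩
  have hε1 : γ * α ^ 2 / 2 ≤ α ^ 2 / 40 := by nlinarith [sq_nonneg α]
  have hε2 : α ^ 2 / 40 ≤ α := by nlinarith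
  refine ⟨γ * α ^ 2 / 2, α, by positivity, by linarith, hα, hα1, fun V _ R hR => ?_⟩
  have := Fintype.ofFinite V
  have ha := hR.ncard_lowDeg_le hα (ht _ (by linarith) hαt) le_rfl
  refine ⟨ha, fun A hA => ?_⟩
  have := Fintype.ofFinite (Aᶜ : Set ((R.lowDeg α)ᶜ : Set V))
  let ι : (Aᶜ : Set ((R.lowDeg α)ᶜ : Set V)) ↪ V := (Function.Embedding.subtype _).trans (.subtype _)
  -- Degrees are measured in all of `R`, so deletions do not lower them; their cost enters only
  -- through `hcard`.
  have hdeg : ∀ a, α * Nat.card V ≤ ∑ v, R.weight (ι a) v := by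
    intro a
    have h1 : ¬ R.deg (ι a) < α * Nat.card V := a.1.2
    rw [WeightedGraph.deg, finsum_eq_sum_of_fintype] at h1
    simpa only [R.weight_symm (ι a)] using not_lt.1 h1
  have hG : ∀ a b, ¬ ((R.deleteVerts (R.lowDeg α)).deleteVerts A).graph.Adj a b →
      R.weight (ι a) (ι b) = 0 := fun a b hab => R.weight_of_not_adj _ _ hab
  -- Both γ and Cγ are below 1/20, so at most αn/10 vertices are deleted in total.
  have hcard : (Nat.card V : ℝ) ≤
      Nat.card (Aᶜ : Set ((R.lowDeg α)ᶜ : Set V)) + α / 10 * Nat.card V := by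
    have h1 := ncard_add_ncard_compl (R.lowDeg α)
    have h2 := ncard_add_ncard_compl A
    rw [Nat.card_coe_set_eq] at h2 ⊢
    have h1' : ((R.lowDeg α).ncard : ℝ) + ((R.lowDeg α)ᶜ).ncard = Nat.card V := by exact_mod_cast h1
    have h2' : (A.ncard : ℝ) + (Aᶜ).ncard = ((R.lowDeg α)ᶜ).ncard := by exact_mod_cast h2
    have hn : (0 : ℝ) ≤ α * Nat.card V := by positivity
    have h3 := mul_le_mul_of_nonneg_right hγ1.le hn
    have h4 := mul_le_mul_of_nonneg_right hCγ.le hn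
    linarith
  exact ⟨hR.isUniquelyHalfCovered_of_embedding hα ht16 hε1 hdeg hG hcard hαδ₂
      (by linarith) hW₂,
    hR.connected_of_embedding hα hα1 ht16 hε1 hdeg hG hcard hαδ₁ hW₁⟩
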